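/- Let $\mathbb N=\{1,2,3,\dots\}$ and let $\ell_\infty$ be the Banach space of bounded real sequences $x=(x_n)_{n\in\mathbb N}$ with the supremum norm. For $\theta\in(0,1)$, $n\in\mathbb N$ and $x\in\ell_\infty$ put $$\Theta_{\theta,n}(x)=\frac{1}{n(1-\theta)}\sum_{i\in\mathbb N,\ \theta n<i\le n}x_i .$$ For an ultrafilter $\mathcal U$ on $\mathbb N$ and a bounded real sequence $(u_n)$ let $\mathcal U\text{-}\lim_n u_n$ denote the limit of $(u_n)$ along $\mathcal U$, i.e. the unique $L\in\mathbb R$ with $\{n:|u_n-L|<\varepsilon\}\in\mathcal U$ for every $\varepsilon>0$. Let $\mathcal E\subseteq\ell_\infty^*$ be the set of all positive functionals extending the Cesàro mean, i.e. of all continuous linear functionals $f:\ell_\infty\to\mathbb R$ such that $f(x)\ge 0$ whenever $x_n\ge 0$ for all $n$, and $f(x)=\lim_{n\to\infty}\frac{x_1+\dots+x_n}{n}$ for every $x\in\ell_\infty$ for which this limit exists. Let $(\theta_k)_{k\in\mathbb N}$ be a sequence in $(0,1)$ with $\theta_k\to1$, and let $\mathcal F$ be a free ultrafilter on $\mathbb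 N$. For every free ultrafilter $\mathcal G$ on $\mathbb N$ let $f_{\mathcal G}\in\ell_\infty^*$ be the functional $$f_{\mathcal G}(x)=\mathcal F\text{-}\lim_k\ \mathcal G\text{-}\lim_n\ \Theta_{\theta_k,n}(x)\qquad(x\in\ell_\infty),$$ and let $S=\{f_{\mathcal G}:\ \mathcal G\text{ is a free ultrafilter on }\mathbb N\}$. Give $\ell_\infty^*$ the weak$^*$ topology. Then the closed convex hull of $S$ is equal to $\mathcal E$. Moreover (equivalently), the closure $\overline S$ contains all extreme points of $\mathcal E$. -/

import Mathlib

open scoped Topology ENNReal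

noncomputable section

namespace CesaroExt

/-- The Banach space `ℓ∞` of bounded real sequences indexed by the positive integers. -/
abbrev LInf : Type := lp (fun _ : ℕ+ => ℝ) ∞

/-- The limit of a real family along an ultrafilter. It is used only for bounded families,
for which it exists and is unique; see `tendsto_ulim`. -/
def ulim {ι : Type*} (U : Ultrafilter ι) (u : ι → ℝ) : ℝ :=
  Filter.limUnder (U : Filter ι) u

/-- An ultrafilter is free if it contains every cofinite set. -/
def IsFree (U : Ultrafilter ℕ+) : Prop :=
  (U : Filter ℕ+) ≤ Filter.cofinite

/-- `Θ_{θ,n}(x)`: the sum of `x i` over the integers `i` in `(θ n, n]`, divided by `n (1 - θ)`. -/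
def Theta (θ : ℝ) (n : ℕ+) (x : LInf) : ℝ :=
  (∑ i ∈ (Finset.Icc 1 n).filter (fun i : ℕ+ => θ * (n : ℝ) < (i : ℝ)), x i) /
    ((n : ℝ) * (1 - θ))

/-- The bounded sequence `x` has Cesàro mean `c`. -/
def HasCesaroMean (x : LInf) (c : ℝ) : Prop :=
  Filter.Tendsto (fun n : ℕ+ => (∑ i ∈ Finset.Icc 1 n, x i) / (n : ℝ)) Filter.atTop (𝓝 c)

/-- The positive functionals in the dual of `ℓ∞` which extend the Cesàro mean, as a subset of the
dual with its weak-* topology. -/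
def positiveCesaroExtensions : Set (WeakDual ℝ LInf) :=
  {f | (∀ x : LInf, (∀ n, 0 ≤ x n) → 0 ≤ f x) ∧ ∀ (x : LInf) (c : ℝ), HasCesaroMean x c → f x = c}

/-! ### The functionals `f_𝓖` are well-defined elements of the dual -/

/-- A bounded real family converges along every ultrafilter, to its `ulim`. -/
theorem tendsto_ulim {ι : Type*} (U : Ultrafilter ι) {u : ι → ℝ} {M : ℝ} (h : ∀ i, |u i| ≤ M) :
    Filter.Tendsto u U (𝓝 (ulim U u)) := by
  have hK : IsCompact (Set.Icc (-M) M) := isCompact_Icc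
  obtain ⟨a, -, ha⟩ := hK.ultrafilter_le_nhds (U.map u) (by
    rw [Filter.le_principal_iff]
    exact Filter.mem_map.2 (Filter.univ_mem' fun i => abs_le.1 (h i)))
  exact tendsto_nhds_limUnder ⟨a, ha⟩

theorem ulim_eq {ι : Type*} {U : Ultrafilter ι} {u : ι → ℝ} {a : ℝ}
    (h : Filter.Tendsto u U (𝓝 a)) : ulim U u = a :=
  h.limUnder_eq

theorem IsFree.le_atTop {U : Ultrafilter ℕ+} (hU : IsFree U) :
    (U : Filter ℕ+) ≤ Filter.atTop := by
  refine hU.trans ?_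
  rw [Filter.atTop, le_iInf_iff]
  intro a
  rw [Filter.le_principal_iff, Filter.mem_cofinite, Set.compl_Ici]
  exact Set.finite_Iio a

theorem card_window_le {θ : ℝ} (hθ : θ ∈ Set.Ioo (0 : ℝ) 1) (n : ℕ+) :
    (((Finset.Icc 1 n).filter (fun i : ℕ+ => θ * (n : ℝ) < (i : ℝ))).card : ℝ) ≤
      (n : ℝ) * (1 - θ) + 1 := by
  have h1 : ((Finset.Icc 1 n).filter (fun i : ℕ+ => θ * (n : ℝ) < (i : ℝ))).card ≤
      (Finset.Ioc ⌊θ * (n : ℝ)⌋₊ (n : ℕ)).card := by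
    refine Finset.card_le_card_of_injOn (fun i : ℕ+ => (i : ℕ)) ?_ PNat.coe_injective.injOn
    intro i hi
    simp only [Finset.coe_filter, Finset.mem_Icc, Set.mem_ofPred_eq] at hi
    have hn : (0 : ℝ) ≤ θ * (n : ℝ) := mul_nonneg hθ.1.le (Nat.cast_nonneg _)
    simp only [Finset.coe_Ioc, Set.mem_Ioc]
    exact ⟨(Nat.floor_lt hn).2 hi.2, hi.1.2⟩
  have hle : ⌊θ * (n : ℝ)⌋₊ ≤ (n : ℕ) := by
    apply Nat.floor_le_of_le
    nlinarith [hθ.2, (Nat.cast_nonneg (n : ℕ) : (0 : ℝ) ≤ ((n : ℕ) : ℝ))]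
  have h2 : (((Finset.Icc 1 n).filter (fun i : ℕ+ => θ * (n : ℝ) < (i : ℝ))).card : ℝ) ≤
      (n : ℝ) - (⌊θ * (n : ℝ)⌋₊ : ℝ) := by
    rw [Nat.card_Ioc] at h1
    calc _ ≤ (((n : ℕ) - ⌊θ * (n : ℝ)⌋₊ : ℕ) : ℝ) := by exact_mod_cast h1
      _ = _ := by rw [Nat.cast_sub hle]
  have := Nat.lt_floor_add_one (θ * (n : ℝ))
  linarith

theorem abs_Theta_le {θ : ℝ} (hθ : θ ∈ Set.Ioo (0 : ℝ) 1) (n : ℕ+) (x : LInf) :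
    |Theta θ n x| ≤ (1 + (1 / (1 - θ)) * (1 / (n : ℝ))) * ‖x‖ := by
  have hn : (0 : ℝ) < (n : ℝ) := by exact_mod_cast n.pos
  have hθ' : (0 : ℝ) < 1 - θ := by linarith [hθ.2]
  rw [Theta, abs_div, abs_of_pos (mul_pos hn hθ'), div_le_iff₀ (mul_pos hn hθ')]
  calc |∑ i ∈ (Finset.Icc 1 n).filter (fun i : ℕ+ => θ * (n : ℝ) < (i : ℝ)), x i|
      ≤ ∑ i ∈ (Finset.Icc 1 n).filter (fun i : ℕ+ => θ * (n : ℝ) < (i : ℝ)), |x i| :=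
        Finset.abs_sum_le_sum_abs _ _
    _ ≤ ∑ i ∈ (Finset.Icc 1 n).filter (fun i : ℕ+ => θ * (n : ℝ) < (i : ℝ)), ‖x‖ :=
        Finset.sum_le_sum fun i _ => lp.norm_apply_le_norm ENNReal.top_ne_zero x i
    _ ≤ ((n : ℝ) * (1 - θ) + 1) * ‖x‖ := by
        rw [Finset.sum_const, nsmul_eq_mul]
        exact mul_le_mul_of_nonneg_right (card_window_le hθ n) (norm_nonneg x)
    _ = _ := by field_simp

theorem tendsto_ulim_Theta {θ : ℝ} (hθ : θ ∈ Set.Ioo (0 : ℝ) 1) (G : Ultrafilter ℕ+) (x : LInf) :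
    Filter.Tendsto (fun n => Theta θ n x) G (𝓝 (ulim G fun n => Theta θ n x)) := by
  have hθ' : (0 : ℝ) < 1 - θ := by linarith [hθ.2]
  refine tendsto_ulim G (M := (1 + (1 / (1 - θ)) * 1) * ‖x‖) fun n => ?_
  refine (abs_Theta_le hθ n x).trans ?_
  have hn : (1 : ℝ) ≤ (n : ℝ) := by exact_mod_cast n.pos
  have hn' : 1 / (n : ℝ) ≤ 1 := by rw [div_le_one (by linarith)]; exact hn
  gcongr

theorem abs_ulim_Theta_le {θ : ℝ} (hθ : θ ∈ Set.Ioo (0 : ℝ) 1) {G : Ultrafilter ℕ+}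
    (hG : IsFree G) (x : LInf) : |ulim G fun n => Theta θ n x| ≤ ‖x‖ := by
  have hnat : Filter.Tendsto (fun n : ℕ+ => (n : ℝ)) Filter.atTop Filter.atTop :=
    tendsto_natCast_atTop_atTop.comp tendsto_PNat_val_atTop_atTop
  have hb : Filter.Tendsto (fun n : ℕ+ => (1 + (1 / (1 - θ)) * (1 / (n : ℝ))) * ‖x‖)
      Filter.atTop (𝓝 ((1 + (1 / (1 - θ)) * 0) * ‖x‖)) := by
    refine ((Filter.Tendsto.const_mul _ ?_).const_add 1).mul_const _
    simpa only [one_div, Function.comp_def] using tendsto_inv_atTop_zero.comp hnat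
  have := le_of_tendsto_of_tendsto' (tendsto_ulim_Theta hθ G x).abs (hb.mono_left hG.le_atTop)
    fun n => abs_Theta_le hθ n x
  simpa using this

theorem tendsto_ulim_ulim_Theta {θ : ℕ+ → ℝ} (hθ : ∀ k, θ k ∈ Set.Ioo (0 : ℝ) 1)
    (F : Ultrafilter ℕ+) {G : Ultrafilter ℕ+} (hG : IsFree G) (x : LInf) :
    Filter.Tendsto (fun k => ulim G fun n => Theta (θ k) n x) F
      (𝓝 (ulim F fun k => ulim G fun n => Theta (θ k) n x)) :=
  tendsto_ulim F fun k => abs_ulim_Theta_le (hθ k) hG x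

theorem Theta_add (θ : ℝ) (n : ℕ+) (x y : LInf) :
    Theta θ n (x + y) = Theta θ n x + Theta θ n y := by
  simp only [Theta, ← add_div, ← Finset.sum_add_distrib]
  rfl

theorem Theta_smul (θ : ℝ) (n : ℕ+) (c : ℝ) (x : LInf) :
    Theta θ n (c • x) = c * Theta θ n x := by
  simp only [Theta, ← mul_div_assoc, Finset.mul_sum]
  rfl

/-- The functional `f_𝓖(x) = 𝓕-lim_k 𝓖-lim_n Θ_{θ_k,n}(x)`, as an element of the dual of `ℓ∞`
with its weak-* topology. -/
def functional (θ : ℕ+ → ℝ) (hθ : ∀ k, θ k ∈ Set.Ioo (0 : ℝ) 1)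
    (F G : Ultrafilter ℕ+) (hG : IsFree G) : WeakDual ℝ LInf :=
  StrongDual.toWeakDual <|
    LinearMap.mkContinuous
      { toFun := fun x : LInf => ulim F fun k => ulim G fun n => Theta (θ k) n x
        map_add' := fun x y => by
          refine ulim_eq ?_
          convert (tendsto_ulim_ulim_Theta hθ F hG x).add (tendsto_ulim_ulim_Theta hθ F hG y)
            using 2 with k
          refine ulim_eq ?_
          simp only [Theta_add]
          exact (tendsto_ulim_Theta (hθ k) G x).add (tendsto_ulim_Theta (hθ k) G y)
        map_smul' := fun c x => by
          rw [RingHom.id_apply, smul_eq_mul]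
          refine ulim_eq ?_
          convert (tendsto_ulim_ulim_Theta hθ F hG x).const_mul c using 2 with k
          refine ulim_eq ?_
          simp only [Theta_smul]
          exact (tendsto_ulim_Theta (hθ k) G x).const_mul c }
      1
      (fun x => by
        rw [one_mul]
        exact le_of_tendsto' (tendsto_ulim_ulim_Theta hθ F hG x).abs
          fun k => abs_ulim_Theta_le (hθ k) hG x)

/-- The defining formula of `functional`. -/
theorem functional_apply (θ : ℕ+ → ℝ) (hθ : ∀ k, θ k ∈ Set.Ioo (0 : ℝ) 1)
    (F G : Ultrafilter ℕ+) (hG : IsFree G) (x : LInf) :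
    functional θ hθ F G hG x = ulim F fun k => ulim G fun n => Theta (θ k) n x :=
  rfl

/-- The set `S` of all functionals `f_𝓖`, where `𝓖` ranges over the free ultrafilters. -/
def functionalSet (θ : ℕ+ → ℝ) (hθ : ∀ k, θ k ∈ Set.Ioo (0 : ℝ) 1)
    (F : Ultrafilter ℕ+) : Set (WeakDual ℝ LInf) :=
  {f | ∃ (G : Ultrafilter ℕ+) (hG : IsFree G), f = functional θ hθ F G hG}

end CesaroExt

end

/-! By Hahn–Banach it suffices that any bound c for all of S at a sequence x also bounds every f in
`positiveCesaroExtensions` at x; this is `apply_le_of_forall_functional_le`. Let W n = x_1 + ⋯ + x_n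
- c n. If window averages exceed some b > a infinitely often for one ratio t, a maximum of the sums
shifted by a n is reached at infinitely many m such that all short windows ending at m have average
about a or more. A free ultrafilter containing these m gives a functional in S with value at least a
(`exists_functional_ge`). Otherwise W n ≤ W ⌊t n⌋ eventually for every t, so W is within o(n) of its
running minimum. The increments of that minimum, raised by c, form a sequence b ≤ c with x - b of
Cesàro mean 0, whence f x = f b ≤ c (`apply_le_of_eventually_window_le`). The extreme points then
follow from Milman's theorem. -/

section Milman

/-! ### Milman's theorem -/

variable {E : Type*} [AddCommGroup E] [Module ℝ E] [TopologicalSpace E]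
  [IsTopologicalAddGroup E] [ContinuousSMul ℝ E]

theorem isCompact_convexJoin {s t : Set E} (hs : IsCompact s) (ht : IsCompact t) :
    IsCompact (convexJoin ℝ s t) := by
  have h : convexJoin ℝ s t =
      (fun p : (E × E) × ℝ => (1 - p.2) • p.1.1 + p.2 • p.1.2) ''
        ((s ×ˢ t) ×ˢ Set.Icc (0 : ℝ) 1) := by
    ext z
    simp only [mem_convexJoin, segment_eq_image, Set.mem_image, Set.mem_prod, Prod.exists]
    constructor
    · rintro ⟨a, ha, b, hb, r, hr, rfl⟩
      exact ⟨a, b, r, ⟨⟨ha, hb⟩, hr⟩, rfl⟩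
    · rintro ⟨a, b, r, ⟨⟨ha, hb⟩, hr⟩, rfl⟩
      exact ⟨a, ha, b, hb, r, hr, rfl⟩
  rw [h]
  exact ((hs.prod ht).prod isCompact_Icc).image (by fun_prop)

/-- **Milman's theorem**: if a compact convex set `C` is contained in the closed convex hull of a
compact subset `K`, then the extreme points of `C` lie in `K`. -/
theorem IsCompact.extremePoints_subset_of_subset_closedConvexHull [T2Space E]
    [LocallyConvexSpace ℝ E] {C K : Set E} (hC : IsCompact C) (hconv : Convex ℝ C)
    (hK : IsCompact K) (hKC : K ⊆ C) (hCK : C ⊆ closedConvexHull ℝ K) :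
    C.extremePoints ℝ ⊆ K := by
  intro e he
  by_contra heK
  have key : ∃ D : Set E, IsCompact D ∧ Convex ℝ D ∧ D ⊆ C ∧ K ⊆ D ∧ e ∉ D := by
    -- Compactness reduces the claim to small pieces of K. Two pieces are merged by joining their
    -- hulls: e is extreme, so it cannot enter the join without being an endpoint of a segment.
    refine hK.induction_on
      (p := fun A => ∃ D : Set E, IsCompact D ∧ Convex ℝ D ∧ D ⊆ C ∧ A ⊆ D ∧ e ∉ D) ?_ ?_ ?_ ?_
    · exact ⟨∅, isCompact_empty, convex_empty, Set.empty_subset _, Set.Subset.rfl,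
        Set.notMem_empty e⟩
    · rintro s t hst ⟨D, h1, h2, h3, h4, h5⟩
      exact ⟨D, h1, h2, h3, hst.trans h4, h5⟩
    · rintro s t ⟨D, h1, h2, h3, h4, h5⟩ ⟨D', h1', h2', h3', h4', h5'⟩
      rcases D.eq_empty_or_nonempty with rfl | hD
      · exact ⟨D', h1', h2', h3', Set.union_subset (h4.trans (Set.empty_subset _)) h4', h5'⟩
      rcases D'.eq_empty_or_nonempty with rfl | hD'
      · exact ⟨D, h1, h2, h3, Set.union_subset h4 (h4'.trans (Set.empty_subset _)), h5⟩
      refine ⟨convexJoin ℝ D D', isCompact_convexJoin h1 h1', h2.convexJoin h2',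
        convexJoin_subset h3 h3' hconv, Set.union_subset (h4.trans (subset_convexJoin_left hD'))
          (h4'.trans (subset_convexJoin_right hD)), fun hmem => ?_⟩
      obtain ⟨a, ha, b, hb, hab⟩ := mem_convexJoin.1 hmem
      rcases (mem_extremePoints_iff_forall_segment.1 he).2 a (h3 ha) b (h3' hb) hab with rfl | rfl
      exacts [h5 ha, h5' hb]
    · intro x hx
      obtain ⟨l, hl⟩ := geometric_hahn_banach_point_point (ne_of_mem_of_not_mem hx heK)
      obtain ⟨r, hr1, hr2⟩ := exists_between hl
      refine ⟨C ∩ {y | l y ≤ r}, ?_, C ∩ {y | l y ≤ r}, ?_, ?_, Set.inter_subset_left,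
        Set.Subset.rfl, fun h => hr2.not_ge h.2⟩
      · refine Filter.mem_of_superset (Filter.inter_mem
          (mem_nhdsWithin_of_mem_nhds ((l.continuous.tendsto x).eventually_lt_const hr1))
            self_mem_nhdsWithin) ?_
        rintro y ⟨hy, hyK⟩
        have hy' : l y < r := hy
        exact ⟨hKC hyK, hy'.le⟩
      · exact hC.inter_right (isClosed_le l.continuous continuous_const)
      · exact hconv.inter (convex_halfSpace_le l.isLinear r)
  obtain ⟨D, h1, h2, -, h4, h5⟩ := key
  exact h5 (closedConvexHull_min h4 h2 h1.isClosed (hCK he.1))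

end Milman

/-! ### Growth of sequences with bounded increments -/

section Sequences

open Filter

theorem sub_le_of_abs_succ_sub_le {V : ℕ → ℝ} {M : ℝ} (hV : ∀ n, |V (n + 1) - V n| ≤ M)
    {l m : ℕ} (h : l ≤ m) : V m - V l ≤ M * ((m : ℝ) - l) := by
  induction m, h using Nat.le_induction with
  | base => simp
  | succ m _ ih =>
    have := (abs_le.1 (hV m)).2
    push_cast
    linarith

/-- A sequence with bounded increments which increases proportionally to `n` on infinitely many
windows `[θ n, n]` has infinitely many indices `m` at which it dominates all its values on a
window `[(1 - δ) m, m]`. -/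
theorem exists_frequently_window_max {V : ℕ → ℝ} {M : ℝ} (hM : 0 < M)
    (hV : ∀ n, |V (n + 1) - V n| ≤ M) {θ η : ℝ} (hθ : θ ≤ 1) (hη : 0 < η)
    (h : ∃ᶠ n : ℕ in atTop, V ⌊θ * n⌋₊ + η * n ≤ V n) :
    ∃ δ > 0, ∃ᶠ m : ℕ in atTop, ∀ t : ℝ, 1 - δ ≤ t → t ≤ 1 → V ⌊t * m⌋₊ ≤ V m := by
  -- A rise of η n in steps of at most M forces the maximizer m on [⌊θ n⌋, n] to lie at least (η /
  -- M) n beyond the left end, so [(1 - δ) m, m] stays inside that window.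
  refine ⟨η / M, div_pos hη hM, ?_⟩
  rw [frequently_atTop] at h ⊢
  intro a
  obtain ⟨n, hn, hVn⟩ := h (⌈(a : ℝ) * M / η⌉₊)
  set q := ⌊θ * n⌋₊ with hq
  have hqn : q ≤ n := Nat.floor_le_of_le (by nlinarith [(Nat.cast_nonneg n : (0 : ℝ) ≤ n)])
  obtain ⟨m, hm, hmax⟩ := (Finset.Icc q n).exists_max_image V ⟨q, by simp [hqn]⟩
  rw [Finset.mem_Icc] at hm
  have h1 := sub_le_of_abs_succ_sub_le hV hm.1
  have h2 := hmax n (by simp [hqn])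
  have h3 : η / M * n ≤ (m : ℝ) - q := by
    rw [div_mul_eq_mul_div, div_le_iff₀ hM]; linarith
  have h4 : (a : ℝ) ≤ η / M * n := by
    have := Nat.ceil_le.1 hn
    rw [div_le_iff₀ hη] at this
    rw [div_mul_eq_mul_div, le_div_iff₀ hM]; linarith
  have hmn : (m : ℝ) ≤ n := by exact_mod_cast hm.2
  have hm0 : (0 : ℝ) ≤ m := Nat.cast_nonneg m
  refine ⟨m, ?_, fun t ht ht1 => hmax _ (Finset.mem_Icc.2 ⟨Nat.le_floor ?_, ?_⟩)⟩
  · have : (0 : ℝ) ≤ q := Nat.cast_nonneg q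
    exact_mod_cast (by linarith : (a : ℝ) ≤ m)
  · have := mul_le_mul_of_nonneg_left hmn (div_pos hη hM).le
    have := mul_le_mul_of_nonneg_right ht hm0
    linarith
  · refine (Nat.floor_le_of_le ?_).trans hm.2
    nlinarith

/-- The running minimum of a sequence. -/
noncomputable def runningMin (W : ℕ → ℝ) : ℕ → ℝ
  | 0 => W 0
  | n + 1 => min (runningMin W n) (W (n + 1))

theorem antitone_runningMin (W : ℕ → ℝ) : Antitone (runningMin W) :=
  antitone_nat_of_succ_le fun _ => min_le_left _ _

theorem runningMin_le (W : ℕ → ℝ) (n : ℕ) : runningMin W n ≤ W n := by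
  cases n with
  | zero => exact le_rfl
  | succ n => exact min_le_right _ _

theorem exists_runningMin_eq (W : ℕ → ℝ) (n : ℕ) : ∃ m ≤ n, runningMin W n = W m := by
  induction n with
  | zero => exact ⟨0, le_rfl, rfl⟩
  | succ n ih =>
    rcases min_choice (runningMin W n) (W (n + 1)) with h | h
    · obtain ⟨m, hm, hWm⟩ := ih
      exact ⟨m, by omega, h.trans hWm⟩
    · exact ⟨n + 1, le_rfl, h⟩

theorem runningMin_sub_succ_le {W : ℕ → ℝ} {M : ℝ} (hW : ∀ n, |W (n + 1) - W n| ≤ M) (n : ℕ) :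
    runningMin W n - runningMin W (n + 1) ≤ M := by
  have hM : 0 ≤ M := (abs_nonneg _).trans (hW 0)
  rcases min_choice (runningMin W n) (W (n + 1)) with h | h
  · rw [runningMin, h]; simpa using hM
  · rw [runningMin, h]
    linarith [runningMin_le W n, (abs_le.1 (hW n)).1]

/-- If a sequence with bounded increments eventually satisfies `W n ≤ W ⌊θ n⌋` for every
`θ ∈ (0, 1)`, then it differs from its running minimum by `o(n)`. -/
theorem tendsto_sub_runningMin_div {W : ℕ → ℝ} {M : ℝ} (hW : ∀ n, |W (n + 1) - W n| ≤ M)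
    (h : ∀ θ : ℝ, 0 < θ → θ < 1 → ∀ᶠ n : ℕ in atTop, W n ≤ W ⌊θ * n⌋₊) :
    Tendsto (fun n : ℕ => (W n - runningMin W n) / n) atTop (𝓝 0) := by
  have hM : 0 ≤ M := (abs_nonneg _).trans (hW 0)
  -- The gap grows with slope at most M (1 - θ), which is arbitrarily small as θ tends to 1.
  have hlin : ∀ θ : ℝ, 0 < θ → θ < 1 →
      ∃ C : ℝ, ∀ n : ℕ, W n - runningMin W n ≤ M * (1 - θ) * n + C := by
    intro θ h0 h1
    obtain ⟨N, hN⟩ := eventually_atTop.1 (h θ h0 h1)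
    have hnn : ∀ n, 0 ≤ W n - runningMin W n := fun n => sub_nonneg.2 (runningMin_le W n)
    refine ⟨∑ i ∈ Finset.range (N + 1), (W i - runningMin W i), fun n => ?_⟩
    have hC := Finset.sum_nonneg fun i (_ : i ∈ Finset.range (N + 1)) => hnn i
    induction n using Nat.strong_induction_on with
    | _ n ih =>
      have hn0 : (0 : ℝ) ≤ n := Nat.cast_nonneg n
      have hc : 0 ≤ M * (1 - θ) := mul_nonneg hM (by linarith)
      rcases lt_or_ge n (N + 1) with hn | hn
      · have := Finset.single_le_sum (f := fun i => W i - runningMin W i) (fun i _ => hnn i)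
          (Finset.mem_range.2 hn)
        have := mul_nonneg hc hn0
        linarith
      · have hn1 : (0 : ℝ) < n := by exact_mod_cast (by omega : 0 < n)
        have hfl : (⌊θ * n⌋₊ : ℝ) ≤ θ * n := Nat.floor_le (by positivity)
        have hlt : ⌊θ * n⌋₊ < n := by
          have : (⌊θ * n⌋₊ : ℝ) < n := by nlinarith
          exact_mod_cast this
        have hstep := hN n (by omega)
        obtain ⟨m, hm, hmeq⟩ := exists_runningMin_eq W n
        -- If the minimum is attained by time ⌊θ n⌋, the gap is no larger than it was then;
        -- otherwise W had fewer than (1 - θ) n steps to rise from it.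
        rcases le_or_gt m ⌊θ * n⌋₊ with hmq | hmq
        · have h2 : runningMin W ⌊θ * n⌋₊ ≤ runningMin W n := by
            rw [hmeq]
            exact (antitone_runningMin W hmq).trans (runningMin_le W m)
          have h3 := ih _ hlt
          have h4 : M * (1 - θ) * (⌊θ * n⌋₊ : ℝ) ≤ M * (1 - θ) * n :=
            mul_le_mul_of_nonneg_left (by exact_mod_cast hlt.le) hc
          linarith
        · have h2 := sub_le_of_abs_succ_sub_le hW hm
          have h3 : θ * n < m := (Nat.floor_lt (by positivity)).1 hmq
          have h4 : M * ((n : ℝ) - m) ≤ M * (1 - θ) * n := by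
            rw [mul_assoc]
            exact mul_le_mul_of_nonneg_left (by linarith) hM
          rw [hmeq]
          linarith
  rw [Metric.tendsto_atTop]
  intro ε hε
  -- This θ makes the slope at most ε / 2; the 1 / 2 keeps θ positive and M + 1 allows M = 0.
  obtain ⟨C, hC⟩ := hlin (1 - min (1 / 2) (ε / (2 * (M + 1))))
    (by linarith [min_le_left (1 / 2 : ℝ) (ε / (2 * (M + 1)))])
    (by linarith [lt_min (by norm_num : (0 : ℝ) < 1 / 2) (by positivity : 0 < ε / (2 * (M + 1)))])
  refine ⟨⌊2 * |C| / ε⌋₊ + 1, fun n hn => ?_⟩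
  have hn1 : (0 : ℝ) < n := by exact_mod_cast (by omega : 0 < n)
  have hCn : 2 * |C| / ε < n := (Nat.floor_lt (by positivity)).1 (by omega)
  rw [div_lt_iff₀ hε] at hCn
  rw [Real.dist_0_eq_abs, abs_of_nonneg (div_nonneg (sub_nonneg.2 (runningMin_le W n)) hn1.le),
    div_lt_iff₀ hn1]
  have hMε : M * min (1 / 2) (ε / (2 * (M + 1))) ≤ ε / 2 := by
    calc M * min (1 / 2) (ε / (2 * (M + 1))) ≤ (M + 1) * (ε / (2 * (M + 1))) := by
          gcongr
          · linarith
          · exact min_le_right _ _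
      _ = ε / 2 := by field_simp
  have h5 := hC n
  rw [sub_sub_cancel] at h5
  have h6 := mul_le_mul_of_nonneg_right hMε hn1.le
  linarith [le_abs_self C]

end Sequences

/-! ### Window averages through partial sums -/

namespace CesaroExt

open Filter

/-- The partial sums `x 1 + ⋯ + x m`. -/
def partialSum (x : LInf) (m : ℕ) : ℝ :=
  ∑ j ∈ Finset.range m, x j.succPNat

theorem partialSum_succ (x : LInf) (m : ℕ) :
    partialSum x (m + 1) = partialSum x m + x m.succPNat :=
  Finset.sum_range_succ _ _

theorem sum_Icc_eq_partialSum (x : LInf) (n : ℕ+) :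
    ∑ i ∈ Finset.Icc 1 n, x i = partialSum x n := by
  refine Finset.sum_nbij' PNat.natPred Nat.succPNat ?_ ?_ ?_ ?_ ?_
  · intro i hi
    have h1 : (i : ℕ) ≤ n := (Finset.mem_Icc.1 hi).2
    have h2 := i.natPred_add_one
    rw [Finset.mem_range]
    omega
  · intro j hj
    rw [Finset.mem_range] at hj
    exact Finset.mem_Icc.2 ⟨one_le, by rw [← PNat.coe_le_coe]; exact hj⟩
  · intro i _
    exact PNat.succPNat_natPred i
  · intro j _
    exact Nat.natPred_succPNat j
  · intro i _
    rw [PNat.succPNat_natPred]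

theorem Theta_eq {θ : ℝ} (h0 : 0 < θ) (h1 : θ < 1) (n : ℕ+) (x : LInf) :
    Theta θ n x =
      (partialSum x n - partialSum x ⌊θ * ((n : ℕ) : ℝ)⌋₊) / (((n : ℕ) : ℝ) * (1 - θ)) := by
  have hn : (0 : ℝ) ≤ ((n : ℕ) : ℝ) := Nat.cast_nonneg _
  have hle : ⌊θ * ((n : ℕ) : ℝ)⌋₊ ≤ (n : ℕ) := Nat.floor_le_of_le (by nlinarith)
  rw [Theta, partialSum, partialSum, ← Finset.sum_Ico_eq_sub _ hle]
  congr 1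
  refine Finset.sum_nbij' PNat.natPred Nat.succPNat ?_ ?_ ?_ ?_ ?_
  · intro i hi
    rw [Finset.mem_filter, Finset.mem_Icc] at hi
    have h1 : (i : ℕ) ≤ n := hi.1.2
    have h2 := i.natPred_add_one
    have h3 : ⌊θ * ((n : ℕ) : ℝ)⌋₊ < (i : ℕ) := (Nat.floor_lt (by positivity)).2 hi.2
    rw [Finset.mem_Ico]
    omega
  · intro j hj
    rw [Finset.mem_Ico] at hj
    refine Finset.mem_filter.2
      ⟨Finset.mem_Icc.2 ⟨one_le, by rw [← PNat.coe_le_coe]; exact hj.2⟩, ?_⟩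
    exact (Nat.floor_lt (by positivity)).1 (Nat.lt_succ_of_le hj.1)
  · intro i _
    exact PNat.succPNat_natPred i
  · intro j _
    exact Nat.natPred_succPNat j
  · intro i _
    rw [PNat.succPNat_natPred]

theorem hasCesaroMean_iff {x : LInf} {c : ℝ} :
    HasCesaroMean x c ↔ Tendsto (fun n : ℕ => partialSum x n / n) atTop (𝓝 c) := by
  simp only [HasCesaroMean, sum_Icc_eq_partialSum]
  exact PNat.tendsto_comp_val_iff (f := fun n : ℕ => partialSum x n / n)

theorem tendsto_floor_mul_div {θ : ℝ} (h0 : 0 ≤ θ) :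
    Tendsto (fun n : ℕ => (⌊θ * (n : ℝ)⌋₊ : ℝ) / n) atTop (𝓝 θ) :=
  (tendsto_nat_floor_mul_div_atTop h0).comp tendsto_natCast_atTop_atTop

theorem tendsto_Theta_of_hasCesaroMean {θ : ℝ} (h0 : 0 < θ) (h1 : θ < 1) {x : LInf} {c : ℝ}
    (hx : HasCesaroMean x c) : Tendsto (fun n => Theta θ n x) atTop (𝓝 c) := by
  simp only [Theta_eq h0 h1]
  refine PNat.tendsto_comp_val_iff (f := fun n : ℕ =>
    (partialSum x n - partialSum x ⌊θ * (n : ℝ)⌋₊) / ((n : ℝ) * (1 - θ))) |>.2 ?_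
  rw [hasCesaroMean_iff] at hx
  have hfl : Tendsto (fun n : ℕ => ⌊θ * (n : ℝ)⌋₊) atTop atTop :=
    tendsto_nat_floor_atTop.comp (tendsto_natCast_atTop_atTop.const_mul_atTop h0)
  -- With q = ⌊θ n⌋, the sum over the window divided by n is S_n / n - (S_q / q)(q / n), which tends
  -- to c - c θ.
  have hlim := (hx.sub ((hx.comp hfl).mul (tendsto_floor_mul_div h0.le))).div_const (1 - θ)
  have hθ : (1 - θ) ≠ 0 := by linarith
  rw [show (c - c * θ) / (1 - θ) = c by field_simp] at hlim
  refine hlim.congr' ?_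
  filter_upwards [hfl.eventually_gt_atTop 0] with n hn
  have : (0 : ℝ) < (⌊θ * (n : ℝ)⌋₊ : ℝ) := by exact_mod_cast hn
  have hn' : (n : ℝ) ≠ 0 := by
    rintro h
    simp [h] at this
  rw [Function.comp_apply, div_mul_div_cancel₀ this.ne', ← sub_div, div_div]

theorem Theta_nonneg {θ : ℝ} (h1 : θ < 1) (n : ℕ+) {x : LInf} (hx : ∀ n, 0 ≤ x n) :
    0 ≤ Theta θ n x :=
  div_nonneg (Finset.sum_nonneg fun i _ => hx i)
    (mul_nonneg (Nat.cast_nonneg _) (by linarith))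

/-! ### The set of positive extensions: it contains S and is convex and weak-* compact -/

variable {θ : ℕ+ → ℝ} {F : Ultrafilter ℕ+}

theorem functionalSet_subset (hθ : ∀ k, θ k ∈ Set.Ioo (0 : ℝ) 1) :
    functionalSet θ hθ F ⊆ positiveCesaroExtensions := by
  rintro _ ⟨G, hG, rfl⟩
  refine ⟨fun x hx => ?_, fun x c hx => ?_⟩
  · rw [functional_apply]
    exact ge_of_tendsto' (tendsto_ulim_ulim_Theta hθ F hG x) fun k =>
      ge_of_tendsto' (tendsto_ulim_Theta (hθ k) G x) fun n => Theta_nonneg (hθ k).2 n hx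
  · rw [functional_apply]
    refine ulim_eq (tendsto_const_nhds.congr fun k => Eq.symm ?_)
    exact ulim_eq ((tendsto_Theta_of_hasCesaroMean (hθ k).1 (hθ k).2 hx).mono_left hG.le_atTop)

/-- The constant sequence `c`. -/
def constSeq (c : ℝ) : LInf :=
  ⟨fun _ => c, memℓp_infty ⟨|c|, by rintro _ ⟨i, rfl⟩; exact le_rfl⟩⟩

theorem constSeq_apply (c : ℝ) (n : ℕ+) : constSeq c n = c := rfl

theorem partialSum_constSeq (c : ℝ) (n : ℕ) : partialSum (constSeq c) n = n * c := by
  simp [partialSum, constSeq_apply]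

theorem hasCesaroMean_constSeq (c : ℝ) : HasCesaroMean (constSeq c) c := by
  rw [hasCesaroMean_iff]
  refine tendsto_const_nhds.congr' ?_
  filter_upwards [eventually_gt_atTop 0] with n hn
  have : (n : ℝ) ≠ 0 := by exact_mod_cast hn.ne'
  rw [partialSum_constSeq]
  field_simp

theorem le_of_forall_le {f : WeakDual ℝ LInf} (hf : f ∈ positiveCesaroExtensions) {x : LInf}
    {c : ℝ} (h : ∀ n, x n ≤ c) : f x ≤ c := by
  have h1 := hf.1 (constSeq c - x) fun n => sub_nonneg.2 (h n)
  rw [map_sub, hf.2 _ c (hasCesaroMean_constSeq c)] at h1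
  linarith

theorem abs_apply_le {f : WeakDual ℝ LInf} (hf : f ∈ positiveCesaroExtensions) (x : LInf) :
    |f x| ≤ ‖x‖ := by
  have hx : ∀ n, |x n| ≤ ‖x‖ := fun n => lp.norm_apply_le_norm ENNReal.top_ne_zero x n
  have h1 := le_of_forall_le hf fun n => (abs_le.1 (hx n)).2
  have h2 := le_of_forall_le hf (x := -x) (c := ‖x‖) fun n => by
    have := (abs_le.1 (hx n)).1
    change -(x n) ≤ _
    linarith
  rw [map_neg] at h2
  exact abs_le.2 ⟨by linarith, h1⟩

theorem isClosed_positiveCesaroExtensions : IsClosed positiveCesaroExtensions := by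
  have h : positiveCesaroExtensions =
      (⋂ (x : LInf) (_ : ∀ n, 0 ≤ x n), {f : WeakDual ℝ LInf | 0 ≤ f x}) ∩
        ⋂ (x : LInf) (c : ℝ) (_ : HasCesaroMean x c), {f : WeakDual ℝ LInf | f x = c} := by
    ext f
    simp [positiveCesaroExtensions]
  rw [h]
  refine IsClosed.inter ?_ ?_
  · exact isClosed_iInter fun x => isClosed_iInter fun _ =>
      isClosed_le continuous_const (WeakDual.eval_continuous x)
  · exact isClosed_iInter fun x => isClosed_iInter fun c => isClosed_iInter fun _ =>
      isClosed_eq (WeakDual.eval_continuous x) continuous_const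

theorem convex_positiveCesaroExtensions : Convex ℝ positiveCesaroExtensions := by
  intro f hf g hg a b ha hb hab
  refine ⟨fun x hx => ?_, fun x c hx => ?_⟩
  · change 0 ≤ a * f x + b * g x
    have := hf.1 x hx
    have := hg.1 x hx
    positivity
  · change a * f x + b * g x = c
    rw [hf.2 x c hx, hg.2 x c hx, ← add_mul, hab, one_mul]

theorem isCompact_positiveCesaroExtensions : IsCompact positiveCesaroExtensions := by
  refine (WeakDual.isCompact_closedBall (𝕜 := ℝ) (0 : StrongDual ℝ LInf) 1).of_isClosed_subset
    isClosed_positiveCesaroExtensions fun f hf => ?_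
  rw [Set.mem_preimage, mem_closedBall_zero_iff]
  exact ContinuousLinearMap.opNorm_le_bound _ zero_le_one fun x => by
    rw [one_mul]; exact abs_apply_le hf x

/-! ### Comparing the suprema over S and over all positive extensions -/

theorem exists_isFree_eventually {p : ℕ → Prop} (h : ∃ᶠ n in atTop, p n) :
    ∃ G : Ultrafilter ℕ+, IsFree G ∧ ∀ᶠ n : ℕ+ in G, p n := by
  have h' : ∃ᶠ n : ℕ+ in atTop, p n := by
    rw [frequently_atTop] at h ⊢
    intro a
    obtain ⟨b, hb, hpb⟩ := h a
    exact ⟨⟨b, a.pos.trans_le hb⟩, hb, hpb⟩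
  have : NeBot (atTop ⊓ 𝓟 {n : ℕ+ | p n}) := frequently_iff_neBot.1 h'
  have hG := Ultrafilter.of_le (atTop ⊓ 𝓟 {n : ℕ+ | p n})
  exact ⟨Ultrafilter.of (atTop ⊓ 𝓟 {n : ℕ+ | p n}), (hG.trans inf_le_left).trans atTop_le_cofinite,
    le_principal_iff.1 (hG.trans inf_le_right)⟩

theorem abs_shifted_partialSum_succ_sub_le (x : LInf) (c : ℝ) (n : ℕ) :
    |(partialSum x (n + 1) - c * ((n + 1 : ℕ) : ℝ)) - (partialSum x n - c * n)| ≤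
      ‖x‖ + |c| := by
  have hx : |x n.succPNat| ≤ ‖x‖ := lp.norm_apply_le_norm ENNReal.top_ne_zero x _
  rw [partialSum_succ, show partialSum x n + x n.succPNat - c * ((n + 1 : ℕ) : ℝ) -
    (partialSum x n - c * n) = x n.succPNat - c by push_cast; ring]
  exact (abs_sub _ _).trans (by gcongr)

/-- If for some `t ∈ (0, 1)` infinitely many window averages of `x` over `(t n, n]` exceed `b`,
and `a < b`, then some `f_𝓖` is at least `a` at `x`. -/
theorem exists_functional_ge (hθ : ∀ k, θ k ∈ Set.Ioo (0 : ℝ) 1) (hlim : Tendsto θ atTop (𝓝 1))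
    (hF : IsFree F) {x : LInf} {a b t : ℝ} (hab : a < b) (ht0 : 0 < t) (ht1 : t < 1)
    (h : ∃ᶠ n : ℕ in atTop, partialSum x ⌊t * n⌋₊ - b * ⌊t * n⌋₊ < partialSum x n - b * n) :
    ∃ f ∈ functionalSet θ hθ F, a ≤ f x := by
  -- Lowering the level from b to a turns mere positivity of the increment into a rise proportional
  -- to n.
  have hfreq : ∃ᶠ n : ℕ in atTop,
      (partialSum x ⌊t * n⌋₊ - a * ⌊t * n⌋₊) + (b - a) * (1 - t) * n ≤
        partialSum x n - a * n := by
    refine h.mono fun n hn => ?_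
    have hfl : (⌊t * n⌋₊ : ℝ) ≤ t * n := Nat.floor_le (by positivity)
    have := mul_le_mul_of_nonneg_left hfl (sub_nonneg.2 hab.le)
    linarith
  obtain ⟨δ, hδ, hm⟩ := exists_frequently_window_max (V := fun n => partialSum x n - a * n)
    (M := ‖x‖ + |a| + 1) (by positivity)
    (fun n => (abs_shifted_partialSum_succ_sub_le x a n).trans (by linarith)) ht1.le
    (mul_pos (sub_pos.2 hab) (sub_pos.2 ht1)) hfreq
  obtain ⟨G, hG, hGm⟩ := exists_isFree_eventually hm
  refine ⟨functional θ hθ F G hG, ⟨G, hG, rfl⟩, ?_⟩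
  rw [functional_apply]
  refine ge_of_tendsto (tendsto_ulim_ulim_Theta hθ F hG x) ?_
  have hk : ∀ᶠ k in (F : Filter ℕ+), 1 - δ < θ k :=
    (hlim.mono_left hF.le_atTop).eventually_const_lt (by linarith)
  filter_upwards [hk] with k hk
  obtain ⟨h0, h1⟩ := hθ k
  have hθ' : (1 - θ k) ≠ 0 := by linarith
  -- The window holds n - ⌊θ n⌋ integers, not exactly n (1 - θ); the ratio tends to 1.
  have hlow : Tendsto (fun n : ℕ+ => a * ((1 - (⌊θ k * ((n : ℕ) : ℝ)⌋₊ : ℝ) / ((n : ℕ) : ℝ)) /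
      (1 - θ k))) G (𝓝 a) := by
    have := ((((tendsto_floor_mul_div h0.le).comp tendsto_PNat_val_atTop_atTop).const_sub
      1).div_const (1 - θ k)).const_mul a
    rw [div_self hθ', mul_one] at this
    exact this.mono_left hG.le_atTop
  refine le_of_tendsto_of_tendsto hlow (tendsto_ulim_Theta (hθ k) G x) ?_
  filter_upwards [hGm] with n hn
  have hn0 : (0 : ℝ) < ((n : ℕ) : ℝ) := by exact_mod_cast n.pos
  rw [Theta_eq h0 h1, le_div_iff₀ (mul_pos hn0 (by linarith))]
  have := hn (θ k) hk.le h1.le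
  calc _ = a * (((n : ℕ) : ℝ) - ⌊θ k * ((n : ℕ) : ℝ)⌋₊) := by field_simp
    _ ≤ _ := by linarith

/-- If for every `t ∈ (0, 1)` the averages of `x` over the windows `(t n, n]` are eventually at
most `c`, then every positive extension of the Cesàro mean is at most `c` at `x`. -/
theorem apply_le_of_eventually_window_le {f : WeakDual ℝ LInf} (hf : f ∈ positiveCesaroExtensions)
    {x : LInf} {c : ℝ}
    (h : ∀ t : ℝ, 0 < t → t < 1 → ∀ᶠ n : ℕ in atTop,
      partialSum x n - c * n ≤ partialSum x ⌊t * n⌋₊ - c * ⌊t * n⌋₊) :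
    f x ≤ c := by
  set W : ℕ → ℝ := fun n => partialSum x n - c * n with hWdef
  have hW : ∀ n, |W (n + 1) - W n| ≤ ‖x‖ + |c| := abs_shifted_partialSum_succ_sub_le x c
  have hlim := tendsto_sub_runningMin_div hW h
  set d : ℕ → ℝ := fun n => runningMin W n - runningMin W (n + 1) with hd
  have hd0 : ∀ n, 0 ≤ d n := fun n => sub_nonneg.2 (antitone_runningMin W n.le_succ)
  have hd1 : ∀ n, d n ≤ ‖x‖ + |c| := runningMin_sub_succ_le hW
  -- The i-th term is c minus the drop of the running minimum from i - 1 to i, so the partial sums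
  -- of x - b telescope to the gap W - `runningMin W`.
  let b : LInf := ⟨fun i => c - d i.natPred, memℓp_infty ⟨|c| + (‖x‖ + |c|), by
    rintro _ ⟨i, rfl⟩
    refine (abs_sub _ _).trans ?_
    rw [abs_of_nonneg (hd0 _)]
    linarith [hd1 i.natPred]⟩⟩
  have hsum : ∀ n, partialSum (x - b) n = W n - runningMin W n := by
    intro n
    induction n with
    | zero => simp [partialSum, runningMin]
    | succ n ih =>
      have hb : (x - b) n.succPNat = x n.succPNat - (c - d n) := by
        change x n.succPNat - (c - d n.succPNat.natPred) = _
        rw [Nat.natPred_succPNat]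
      rw [partialSum_succ, ih, hb]
      simp only [hd, hWdef, partialSum_succ]
      push_cast
      ring
  have hces : HasCesaroMean (x - b) 0 := by
    rw [hasCesaroMean_iff]
    simpa only [hsum] using hlim
  have h1 := hf.2 _ _ hces
  have h2 : f b ≤ c := le_of_forall_le hf fun n => sub_le_self c (hd0 _)
  rw [map_sub] at h1
  linarith

theorem apply_le_of_forall_functional_le (hθ : ∀ k, θ k ∈ Set.Ioo (0 : ℝ) 1)
    (hlim : Tendsto θ atTop (𝓝 1)) (hF : IsFree F) {x : LInf} {c : ℝ}
    (hc : ∀ g ∈ functionalSet θ hθ F, g x ≤ c) {f : WeakDual ℝ LInf}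
    (hf : f ∈ positiveCesaroExtensions) : f x ≤ c := by
  -- The slack ε leaves room for the level c + ε / 2, still above c, at which a functional of S
  -- would contradict the bound.
  refine le_of_forall_pos_le_add fun ε hε => apply_le_of_eventually_window_le hf ?_
  by_contra hcon
  push Not at hcon
  obtain ⟨t, ht0, ht1, ht⟩ := hcon
  obtain ⟨g, hg, hgx⟩ := exists_functional_ge hθ hlim hF (a := c + ε / 2) (b := c + ε)
    (by linarith) ht0 ht1 (ht.mono fun n hn => hn)
  linarith [hc g hg]

/-! ### Weak-* separation and conclusion -/

instance : LocallyConvexSpace ℝ (WeakDual ℝ LInf) :=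
  inferInstanceAs (LocallyConvexSpace ℝ (WeakBilin (topDualPairing ℝ LInf)))

/-- Turns a separating functional on the dual into a sequence x, so that separation becomes a
comparison of values at x. -/
theorem exists_eq_eval (l : StrongDual ℝ (WeakDual ℝ LInf)) :
    ∃ x : LInf, ∀ f : WeakDual ℝ LInf, l f = f x := by
  obtain ⟨x, hx⟩ := LinearMap.dualEmbedding_surjective (topDualPairing ℝ LInf) l
  exact ⟨x, fun f => (DFunLike.congr_fun hx f).symm⟩

theorem closedConvexHull_functionalSet (hθ : ∀ k, θ k ∈ Set.Ioo (0 : ℝ) 1)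
    (hlim : Tendsto θ atTop (𝓝 1)) (hF : IsFree F) :
    closedConvexHull ℝ (functionalSet θ hθ F) = positiveCesaroExtensions := by
  refine Set.Subset.antisymm (closedConvexHull_min (functionalSet_subset hθ)
    convex_positiveCesaroExtensions isClosed_positiveCesaroExtensions) fun f hf => ?_
  by_contra hfS
  obtain ⟨l, u, hlu, hul⟩ :=
    geometric_hahn_banach_closed_point convex_closedConvexHull isClosed_closedConvexHull hfS
  obtain ⟨x, hx⟩ := exists_eq_eval l
  refine hul.not_ge ?_
  rw [hx]
  refine apply_le_of_forall_functional_le hθ hlim hF (fun g hg => ?_) hf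
  rw [← hx]
  exact (hlu g (subset_closedConvexHull hg)).le

end CesaroExt

theorem theorem6 (θ : ℕ+ → ℝ) (hθ : ∀ k, θ k ∈ Set.Ioo (0 : ℝ) 1)
    (hlim : Filter.Tendsto θ Filter.atTop (𝓝 1))
    (F : Ultrafilter ℕ+) (hF : CesaroExt.IsFree F) :
    closedConvexHull ℝ (CesaroExt.functionalSet θ hθ F) = CesaroExt.positiveCesaroExtensions ∧
      Set.extremePoints ℝ CesaroExt.positiveCesaroExtensions ⊆
        closure (CesaroExt.functionalSet θ hθ F) := by
  have hhull := CesaroExt.closedConvexHull_functionalSet hθ hlim hF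
  have hsub : closure (CesaroExt.functionalSet θ hθ F) ⊆ CesaroExt.positiveCesaroExtensions :=
    closure_minimal (CesaroExt.functionalSet_subset hθ)
      CesaroExt.isClosed_positiveCesaroExtensions
  refine ⟨hhull, ?_⟩
  refine IsCompact.extremePoints_subset_of_subset_closedConvexHull
    CesaroExt.isCompact_positiveCesaroExtensions CesaroExt.convex_positiveCesaroExtensions
    (CesaroExt.isCompact_positiveCesaroExtensions.of_isClosed_subset isClosed_closure hsub)
    hsub ?_
  rw [closedConvexHull_closure_eq_closedConvexHull, hhull]
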